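/- A \emph{dimension group} is a directed, unperforated partially ordered abelian group with the Riesz interpolation property; it is \emph{simple} if it is nonzero and its only order ideals (convex directed subgroups) are $0$ and the whole group. A \emph{trace} on $G$ is a nonzero positive group homomorphism $G\to\mathbf R$, and $\tau$ is the \emph{unique} trace if every trace is a positive scalar multiple of $\tau$. For a subgroup $H$ of $G$, an \emph{equal row sum (ERS) realization of $G$ with respect to $H$} consists of positive integers $f(n)$, matrices $A_n\in \mathbf Z^{f(n+1)\times f(n)}$ with nonnegative entries, positive integers $p_{n+1}$ such that every row of $A_n$ has sum $p_{n+1}$, and a group isomorphism $\phi: G\to \varinjlim (A_n:\mathbf Z^{f(n)}\to\mathbf Z^{f(n+1)})$ that carries the positive cone of $G$ onto the cone of the direct limit ordering (the set of classes $[v,n]$ with $v\ge 0$ coordinatewise) and satisfies $\phi(H)=\bigcup_n[\mathbf 1_{f(n)},n]\mathbf Z$, where $\mathbf 1_{f(n)}$ is the column of ones. It is \emph{of size $s$} if $f(n)=s$ for all $n$. For a group homomorphism $t: J\to M$ of abelian groups, the extension $0\to\ker t\to J\to t(J)\to 0$ is \emph{nearly split} if there is a subgroup $H_0$ of $J$ with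 $H_0\cap\ker t=0$ such that $\ker t\oplus H_0$ has finite index in $J$. \textbf{Theorem.} Let $G$ be a countable simple dimension group with unique trace $\tau$, and let $H$ be a noncyclic rank-one subgroup of $G$ such that $\tau(H)\neq 0$ and $G/H$ is torsion-free. (a) If $\operatorname{rank} G=k+1$ with $k\ge 0$ an integer, then there exists an ERS realization of $G$ with respect to $H$ of size $k+2$; if moreover $G/H$ is free, then the extension $0\to\ker\tau\to G\to\tau(G)\to 0$ is nearly split. (b) Without any restriction on the rank of $G$, there exists an ERS realization of $G$ with respect to $H$. -/

import Mathlib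

namespace ERS

/-- Dimension group: a directed, unperforated partially ordered abelian group with the
Riesz interpolation property. -/
structure IsDimensionGroup (G : Type*) [AddCommGroup G] [PartialOrder G]
    [IsOrderedAddMonoid G] : Prop where
  directed : ∀ a b : G, ∃ c, a ≤ c ∧ b ≤ c
  unperforated : ∀ (n : ℕ) (g : G), 0 < n → 0 ≤ n • g → 0 ≤ g
  interpolation : ∀ a₁ a₂ b₁ b₂ : G, a₁ ≤ b₁ → a₁ ≤ b₂ → a₂ ≤ b₁ → a₂ ≤ b₂ →
    ∃ c, a₁ ≤ c ∧ a₂ ≤ c ∧ c ≤ b₁ ∧ c ≤ b₂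

/-- Order ideal: a convex directed subgroup. -/
structure IsOrderIdeal {G : Type*} [AddCommGroup G] [PartialOrder G]
    (I : AddSubgroup G) : Prop where
  convex : ∀ a b : G, 0 ≤ a → a ≤ b → b ∈ I → a ∈ I
  directed : ∀ x ∈ I, ∃ y ∈ I, ∃ z ∈ I, 0 ≤ y ∧ 0 ≤ z ∧ x = y - z

/-- A simple dimension group: nonzero, and without order ideals other than `0` and `G`. -/
structure IsSimpleDimensionGroup (G : Type*) [AddCommGroup G] [PartialOrder G]
    [IsOrderedAddMonoid G] : Prop extends IsDimensionGroup G where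
  nontrivial : Nontrivial G
  simple : ∀ I : AddSubgroup G, IsOrderIdeal I → I = ⊥ ∨ I = ⊤

/-- A trace: a nonzero positive group homomorphism to the reals. -/
structure IsTrace {G : Type*} [AddCommGroup G] [PartialOrder G] (τ : G →+ ℝ) : Prop where
  nonneg : ∀ g : G, 0 ≤ g → 0 ≤ τ g
  ne_zero : τ ≠ 0

/-- `τ` is the unique trace of `G`, up to the usual positive scalar multiple. -/
structure IsUniqueTrace {G : Type*} [AddCommGroup G] [PartialOrder G] (τ : G →+ ℝ) : Prop where
  isTrace : IsTrace τ
  unique : ∀ σ : G →+ ℝ, IsTrace σ → ∃ c : ℝ, 0 < c ∧ ∀ g, σ g = c * τ g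

section Limit

variable {f : ℕ → ℕ} (A : ∀ n, Matrix (Fin (f (n + 1))) (Fin (f n)) ℤ)

/-- The composite `A (n-1) ∘ ⋯ ∘ A m : ℤ^{f m} → ℤ^{f n}`. -/
def transition (m n : ℕ) (h : m ≤ n) : (Fin (f m) → ℤ) →+ (Fin (f n) → ℤ) :=
  Nat.leRecOn (C := fun j => (Fin (f m) → ℤ) →+ (Fin (f j) → ℤ)) h
    (fun {j} g => (A j).mulVecLin.toAddMonoidHom.comp g) (AddMonoidHom.id _)

/-- The direct limit group `lim A n : ℤ^{f n} → ℤ^{f (n+1)}`. -/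
abbrev MatrixLimit : Type :=
  AddCommGroup.DirectLimit (fun n => Fin (f n) → ℤ) (transition A)

/-- The class `[v, n]` in the direct limit. -/
noncomputable abbrev limitClass (n : ℕ) : (Fin (f n) → ℤ) →+ MatrixLimit A :=
  AddCommGroup.DirectLimit.of (fun n => Fin (f n) → ℤ) (transition A) n

/-- The positive cone of the direct limit ordering. -/
def limitCone : Set (MatrixLimit A) :=
  {x | ∃ (n : ℕ) (v : Fin (f n) → ℤ), (∀ i, 0 ≤ v i) ∧ x = limitClass A n v}

end Limit

/-- An equal row sum realization of `G` with respect to the subgroup `H`. -/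
structure ERSRealization (G : Type*) [AddCommGroup G] [PartialOrder G]
    (H : AddSubgroup G) where
  /-- matrix sizes -/
  size : ℕ → ℕ
  size_pos : ∀ n, 0 < size n
  /-- the transition matrices -/
  mat : ∀ n, Matrix (Fin (size (n + 1))) (Fin (size n)) ℤ
  mat_nonneg : ∀ n i j, 0 ≤ mat n i j
  /-- the common row sum of each matrix -/
  rowSum : ℕ → ℤ
  rowSum_pos : ∀ n, 0 < rowSum n
  sum_row : ∀ n i, ∑ j, mat n i j = rowSum n
  /-- the group isomorphism with the limit -/
  iso : G ≃+ MatrixLimit mat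
  /-- the isomorphism identifies the positive cones -/
  iso_order : ∀ g : G, 0 ≤ g ↔ iso g ∈ limitCone mat
  /-- `H` is carried onto `⋃ n, [1, n] ℤ` -/
  iso_image : iso '' (H : Set G) = ⋃ n, {x | ∃ z : ℤ, x = z • limitClass mat n (fun _ => 1)}

/-- The extension `0 → ker t → J → t(J) → 0` is nearly split: some subgroup of finite index in `J`
is an internal direct sum `ker t ⊕ H₀`. -/
def NearlySplit {J M : Type*} [AddCommGroup J] [AddCommGroup M] (t : J →+ M) : Prop :=
  ∃ J₀ H₀ : AddSubgroup J, Disjoint t.ker H₀ ∧ t.ker ⊔ H₀ = J₀ ∧ J₀.FiniteIndex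

end ERS

/-!
By uniqueness of the trace, `0 < g` exactly when `0 < τ g`: if `g` is not nonnegative, adjoining
`-g` to the positive cone leaves it proper, since `G` is unperforated, and a trace for the enlarged
cone is nonpositive at `g`.

A realization amounts to an exhaustion of `G` by finitely generated subgroups whose inclusions
factor through `ℤ ^ s`, with nonnegative coordinates at finitely many prescribed positive elements.
To factor `M`, split its image in `G / H`, so that `M` lies in the span of some `u ∈ H` and of
lifts `l j`, and divide `u` by a large integer, which the noncyclic group `H` permits. Normalize
`τ u = 1` and write `u = N • h` with `N` large. The points `0`, `h` and the `l j`, the latter moved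
by small multiples of `h` to make all points distinct, cut the circle `ℝ / ℤ` into `k + 2` arcs,
which lift to positive elements of `G` with sum `u`. The arc coordinates of `x` differ from `τ x` by
a bounded amount; since `τ x` grows when a smaller `u` is normalized, they are nonnegative once `u`
is small enough.

The extension nearly splits because `H` meets `ker τ` trivially and, modulo torsion, the finitely
generated group `G / (ker τ + H)` lifts to `G`.
-/

namespace ERS

section States

variable {G : Type*} [AddCommGroup G]

theorem exists_addSubmonoid_notMem_forall_add_nsmul_eq {M : Type*} [AddCommMonoid M]
    (C : AddSubmonoid M) {a : M} (ha : a ∉ C) :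
    ∃ P : AddSubmonoid M, C ≤ P ∧ a ∉ P ∧ ∀ x ∉ P, ∃ p ∈ P, ∃ n : ℕ, p + n • x = a := by
  obtain ⟨P, hCP, hP⟩ := zorn_le_nonempty₀ {P : AddSubmonoid M | a ∉ P}
    (fun c hc hchain Q hQ => by
      refine ⟨sSup c, fun hmem => ?_, fun _ => le_sSup⟩
      obtain ⟨R, hR, haR⟩ :=
        (AddSubmonoid.mem_sSup_of_directedOn ⟨Q, hQ⟩ hchain.directedOn).1 hmem
      exact hc hR haR) C ha
  refine ⟨P, hCP, hP.prop, fun x hx => ?_⟩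
  have ha_mem : a ∈ P ⊔ AddSubmonoid.multiples x := by
    by_contra hna
    exact hx (hP.le_of_ge hna le_sup_left
      (AddSubmonoid.mem_sup_right (AddSubmonoid.mem_multiples x)))
  obtain ⟨p, hp, _, ⟨n, rfl⟩, hpn⟩ := AddSubmonoid.mem_sup.1 ha_mem
  exact ⟨p, hp, n, hpn⟩

section Quotient

variable {P : AddSubmonoid G} {u : G}

theorem mk_mem_map_mk'_support_iff {x : G} :
    (x : G ⧸ P.support) ∈ P.map (QuotientAddGroup.mk' P.support) ↔ x ∈ P := by
  refine ⟨fun ⟨y, hy, hyx⟩ => ?_, fun hx => ⟨x, hx, rfl⟩⟩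
  have hxy : -y + x ∈ P := (QuotientAddGroup.eq.1 hyx).1
  simpa using P.add_mem hy hxy

/-- The cone induced by `P` on the largest quotient of `G` in which it becomes pointed. -/
def quotientCone (P : AddSubmonoid G) : AddGroupCone (G ⧸ P.support) where
  toAddSubmonoid := P.map (QuotientAddGroup.mk' P.support)
  eq_zero_of_mem_of_neg_mem' {a} := by
    induction a using QuotientAddGroup.induction_on with
    | H x =>
      intro hx hnx
      exact (QuotientAddGroup.eq_zero_iff x).2
        ⟨mk_mem_map_mk'_support_iff.1 hx,
          (mk_mem_map_mk'_support_iff (P := P) (x := -x)).1 hnx⟩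

theorem mk_mem_quotientCone {x : G} : (x : G ⧸ P.support) ∈ quotientCone P ↔ x ∈ P :=
  mk_mem_map_mk'_support_iff

/-- The hypothesis `hP` says that, for the preorder on `G` with positive cone `P`, an element which
is not nonnegative lies below `-u / n` for some `n`: this makes the preorder total, and Archimedean
once infinitesimals are factored out. -/
theorem exists_real_hom_of_archimedean (hu : u ∈ P) (hnu : -u ∉ P)
    (hunit : ∀ x, ∃ n : ℕ, n • u - x ∈ P) (hP : ∀ x ∉ P, ∃ n : ℕ, -(n • x) - u ∈ P) :
    ∃ σ : G →+ ℝ, (∀ x ∈ P, 0 ≤ σ x) ∧ 0 < σ u := by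
  classical
  have htotal (x : G) : x ∈ P ∨ -x ∈ P := by
    by_contra! h
    obtain ⟨n, hn⟩ := hP x h.1
    obtain ⟨m, hm⟩ := hP (-x) h.2
    rcases n with _ | n
    · exact hnu (by simpa using hn)
    have hsum : -u = m • (-((n + 1) • x) - u) + (n + 1) • (-(m • -x) - u) + (m + n) • u := by
      module
    rw [hsum] at hnu
    exact hnu (P.add_mem (P.add_mem (P.nsmul_mem hn m) (P.nsmul_mem hm _)) (P.nsmul_mem hu _))
  let : LinearOrder (G ⧸ P.support) :=
    have : HasMemOrNegMem (quotientCone P) :=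
      ⟨fun a => QuotientAddGroup.induction_on a fun x => by
        simpa only [← QuotientAddGroup.mk_neg, mk_mem_quotientCone] using htotal x⟩
    LinearOrder.mkOfAddGroupCone (quotientCone P)
  have : IsOrderedAddMonoid (G ⧸ P.support) := IsOrderedAddMonoid.mkOfCone (quotientCone P)
  have hle (x y : G) : (x : G ⧸ P.support) ≤ y ↔ y - x ∈ P := mk_mem_quotientCone
  have : Archimedean (G ⧸ P.support) := by
    refine ⟨fun a b => ?_⟩
    induction a using QuotientAddGroup.induction_on with | H x
    induction b using QuotientAddGroup.induction_on with | H y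
    intro hy
    obtain ⟨n, hn⟩ := hP (-y) (by simpa using (hle y 0).not.1 hy.not_ge)
    obtain ⟨m, hm⟩ := hunit x
    refine ⟨m * n, (hle x ((m * n) • y)).2 ?_⟩
    have hsum : (m * n) • y - x = m • (-(n • -y) - u) + (m • u - x) := by module
    rw [hsum]
    exact P.add_mem (P.nsmul_mem hn m) hm
  obtain ⟨f, hf⟩ := Archimedean.exists_orderAddMonoidHom_real_injective (G ⧸ P.support)
  have hnonneg (x : G) (hx : x ∈ P) : 0 ≤ f x := by
    simpa using f.monotone' ((hle 0 x).2 (by simpa using hx))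
  refine ⟨(f : (G ⧸ P.support) →+ ℝ).comp (QuotientAddGroup.mk' P.support), hnonneg,
    (hnonneg u hu).lt_of_ne fun h => hnu ?_⟩
  have hu0 : (u : G ⧸ P.support) = 0 := hf (by simpa using h.symm)
  exact ((QuotientAddGroup.eq_zero_iff u).1 hu0).2

end Quotient

theorem exists_real_hom_of_neg_notMem (C : AddSubmonoid G) {u : G} (hu : u ∈ C) (hnu : -u ∉ C)
    (hunit : ∀ x, ∃ n : ℕ, n • u - x ∈ C) :
    ∃ σ : G →+ ℝ, (∀ x ∈ C, 0 ≤ σ x) ∧ 0 < σ u := by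
  obtain ⟨P, hCP, hnuP, hmax⟩ := exists_addSubmonoid_notMem_forall_add_nsmul_eq C hnu
  obtain ⟨σ, hσ, hσu⟩ := exists_real_hom_of_archimedean (hCP hu) hnuP
    (fun x => (hunit x).imp fun _ hn => hCP hn) (fun x hx => by
      obtain ⟨p, hp, n, hpn⟩ := hmax x hx
      have hp_eq : -(n • x) - u = p := by
        rw [sub_eq_add_neg, ← hpn]
        abel
      exact ⟨n, hp_eq ▸ hp⟩)
  exact ⟨σ, fun x hx => hσ x (hCP hx), hσu⟩

end States

section Order

variable {G : Type*} [AddCommGroup G] [PartialOrder G] [IsOrderedAddMonoid G]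

theorem isAddTorsionFree_of_unperforated
    (hunperf : ∀ (n : ℕ) (g : G), 0 < n → 0 ≤ n • g → 0 ≤ g) : IsAddTorsionFree G := by
  refine ⟨fun n hn => (injective_iff_map_eq_zero (nsmulAddMonoidHom (α := G) n)).2 fun x hx => ?_⟩
  have hx0 : n • x = 0 := hx
  have hn0 := Nat.pos_of_ne_zero hn
  exact le_antisymm (neg_nonneg.1 (hunperf n (-x) hn0 (by simp [hx0]))) (hunperf n x hn0 hx0.ge)

theorem exists_le_nsmul_of_forall_isOrderIdeal
    (hsimple : ∀ I : AddSubgroup G, IsOrderIdeal I → I = ⊥ ∨ I = ⊤) {u : G} (hu : 0 < u) (x : G) :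
    ∃ n : ℕ, x ≤ n • u := by
  let I : AddSubgroup G :=
    { carrier := {x | ∃ n : ℕ, x ≤ n • u ∧ -x ≤ n • u}
      zero_mem' := ⟨0, by simp⟩
      add_mem' := fun {a b} ⟨n, ha, ha'⟩ ⟨m, hb, hb'⟩ =>
        ⟨n + m, by simpa only [add_smul] using add_le_add ha hb, by
          simpa only [add_smul, neg_add] using add_le_add ha' hb'⟩
      neg_mem' := fun ⟨n, h, h'⟩ => ⟨n, h', by simpa using h⟩ }
  have huI : u ∈ I := ⟨1, by simp, by simpa using (neg_nonpos.2 hu.le).trans hu.le⟩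
  have hI : IsOrderIdeal I :=
    { convex := fun a b ha hab ⟨n, hb, _⟩ =>
        ⟨n, hab.trans hb, (neg_nonpos.2 ha).trans (ha.trans (hab.trans hb))⟩
      directed := fun x ⟨n, hx, hx'⟩ =>
        ⟨x + n • u, I.add_mem ⟨n, hx, hx'⟩ (I.nsmul_mem huI n), n • u, I.nsmul_mem huI n,
          neg_le_iff_add_nonneg'.1 hx', nsmul_nonneg hu.le n, by simp⟩ }
  have hI_top : I = ⊤ := (hsimple I hI).resolve_left fun h =>
    hu.ne' (AddSubgroup.mem_bot.1 (h ▸ huI))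
  obtain ⟨n, hn, -⟩ : x ∈ I := hI_top ▸ AddSubgroup.mem_top x
  exact ⟨n, hn⟩

theorem IsTrace.map_pos {τ : G →+ ℝ} (hτ : IsTrace τ) {u : G} (hu : 0 ≤ u)
    (hunit : ∀ x, ∃ n : ℕ, x ≤ n • u) : 0 < τ u := by
  refine (hτ.nonneg u hu).lt_of_ne fun hu0 => hτ.ne_zero ?_
  have hle (x : G) : τ x ≤ 0 := by
    obtain ⟨n, hn⟩ := hunit x
    simpa [← hu0] using hτ.nonneg _ (sub_nonneg.2 hn)
  ext x
  exact le_antisymm (hle x) (by simpa using hle (-x))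

theorem exists_isTrace_map_nonpos
    (hunperf : ∀ (n : ℕ) (g : G), 0 < n → 0 ≤ n • g → 0 ≤ g) {u : G} (hu : 0 < u)
    (hunit : ∀ x, ∃ n : ℕ, x ≤ n • u) {g : G} (hg : ¬ 0 ≤ g) :
    ∃ σ : G →+ ℝ, IsTrace σ ∧ σ g ≤ 0 := by
  let C : AddSubmonoid G := AddSubmonoid.nonneg G ⊔ AddSubmonoid.multiples (-g)
  have hnonneg {x : G} (hx : 0 ≤ x) : x ∈ C := AddSubmonoid.mem_sup_left hx
  have hnu : -u ∉ C := by
    intro hmem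
    obtain ⟨a, ha, _, ⟨n, rfl⟩, han⟩ := AddSubmonoid.mem_sup.1 hmem
    have ha0 : 0 ≤ a := ha
    have hng : n • g = a + u := by
      rw [← neg_neg u, ← han]
      simp
    rcases n.eq_zero_or_pos with rfl | hn
    · exact (add_pos_of_nonneg_of_pos ha0 hu).ne (by simpa using hng)
    · exact hg (hunperf n g hn (hng ▸ add_nonneg ha0 hu.le))
  obtain ⟨σ, hσ, hσu⟩ := exists_real_hom_of_neg_notMem C (hnonneg hu.le) hnu
    fun x => (hunit x).imp fun _ hn => hnonneg (sub_nonneg.2 hn)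
  refine ⟨σ, ⟨fun x hx => hσ x (hnonneg hx), fun h => by simp [h] at hσu⟩, ?_⟩
  simpa using hσ (-g) (AddSubmonoid.mem_sup_right (AddSubmonoid.mem_multiples _))

theorem IsSimpleDimensionGroup.exists_pos (hG : IsSimpleDimensionGroup G) : ∃ u : G, 0 < u := by
  have := hG.nontrivial
  obtain ⟨g, hg⟩ := exists_ne (0 : G)
  obtain ⟨c, hc0, hcg⟩ := hG.directed 0 g
  rcases hc0.eq_or_lt with rfl | hc
  · exact ⟨-g, neg_pos.2 (hcg.lt_of_ne hg)⟩
  · exact ⟨c, hc⟩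

theorem IsSimpleDimensionGroup.pos_iff_map_pos (hG : IsSimpleDimensionGroup G) {τ : G →+ ℝ}
    (hτ : IsUniqueTrace τ) (g : G) : 0 < g ↔ 0 < τ g := by
  have hunit {u : G} (hu : 0 < u) := exists_le_nsmul_of_forall_isOrderIdeal hG.simple hu
  refine ⟨fun hg => hτ.isTrace.map_pos hg.le (hunit hg), fun hg => ?_⟩
  have hg0 : g ≠ 0 := by
    rintro rfl
    simp at hg
  by_contra hng
  obtain ⟨u, hu⟩ := hG.exists_pos
  obtain ⟨σ, hσ, hσg⟩ := exists_isTrace_map_nonpos hG.unperforated hu (hunit hu)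
    fun h => hng (h.lt_of_ne hg0.symm)
  obtain ⟨c, hc, hστ⟩ := hτ.unique σ hσ
  exact (hστ g ▸ mul_pos hc hg).not_ge hσg

end Order

section RankOne

variable {A : Type*} [AddCommGroup A] [IsAddTorsionFree A]

theorem exists_le_zmultiples_of_fg (hA : Module.rank ℤ A ≤ 1) {B : AddSubgroup A} (hB : B.FG) :
    ∃ w, B ≤ AddSubgroup.zmultiples w := by
  let N := AddSubgroup.toIntSubmodule B
  have : Module.Finite ℤ N :=
    Module.Finite.of_fg ((Submodule.fg_iff_addSubgroup_fg N).2 (by simpa [N] using hB))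
  have hN : Module.rank ℤ N ≤ 1 := (Submodule.rank_le N).trans hA
  obtain ⟨w, hw⟩ := rank_le_one_iff.1 hN
  refine ⟨w, fun x hx => ?_⟩
  obtain ⟨n, hn⟩ := hw ⟨x, hx⟩
  exact ⟨n, congrArg Subtype.val hn⟩

theorem exists_zsmul_eq_and_zsmul_eq (hA : Module.rank ℤ A ≤ 1) (x y : A) :
    ∃ (w : A) (m n : ℤ), m • w = x ∧ n • w = y := by
  obtain ⟨w, hw⟩ := exists_le_zmultiples_of_fg hA
    ((AddSubgroup.fg_iff _).2 ⟨{x, y}, rfl, Set.toFinite _⟩)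
  obtain ⟨m, hm⟩ := hw (AddSubgroup.subset_closure (Set.mem_insert x {y}))
  obtain ⟨n, hn⟩ := hw (AddSubgroup.subset_closure (Set.mem_insert_of_mem x rfl))
  exact ⟨w, m, n, hm, hn⟩

theorem injective_of_ne_zero {V : Type*} [AddCommGroup V] [IsAddTorsionFree V]
    (hA : Module.rank ℤ A ≤ 1) {f : A →+ V} (hf : f ≠ 0) : Function.Injective f := by
  refine (injective_iff_map_eq_zero f).2 fun x hx => ?_
  by_contra hx0
  refine hf (AddMonoidHom.ext fun y => ?_)
  obtain ⟨w, m, n, rfl, rfl⟩ := exists_zsmul_eq_and_zsmul_eq hA x y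
  have hw : f w = 0 := (smul_eq_zero.1 ((map_zsmul f m w).symm.trans hx)).resolve_left (by
    rintro rfl
    simp at hx0)
  simp [hw]

theorem exists_map_pos_le_zmultiples_of_fg (hA : Module.rank ℤ A ≤ 1) {f : A →+ ℝ} (hf : f ≠ 0)
    {B : AddSubgroup A} (hB : B.FG) : ∃ u, 0 < f u ∧ B ≤ AddSubgroup.zmultiples u := by
  obtain ⟨y, hy⟩ := DFunLike.ne_iff.1 hf
  obtain ⟨w, hw⟩ := exists_le_zmultiples_of_fg hA
    (hB.sup ((AddSubgroup.fg_iff _).2 ⟨{y}, rfl, Set.finite_singleton y⟩))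
  obtain ⟨n, rfl⟩ := hw (AddSubgroup.mem_sup_right
    (AddSubgroup.subset_closure (Set.mem_singleton y)))
  have hfw : f w ≠ 0 := fun h => hy (by simp [h])
  rcases hfw.lt_or_gt with hneg | hpos
  · exact ⟨-w, by simpa using hneg, by
      rw [AddSubgroup.zmultiples_neg]
      exact le_sup_left.trans hw⟩
  · exact ⟨w, hpos, le_sup_left.trans hw⟩

theorem exists_nsmul_eq_of_not_isAddCyclic (hA : Module.rank ℤ A ≤ 1) (hcyc : ¬ IsAddCyclic A)
    (v : A) : ∃ (n : ℕ) (w : A), 2 ≤ n ∧ n • w = v := by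
  obtain ⟨y, hy⟩ : ∃ y, y ∉ AddSubgroup.zmultiples v := by
    by_contra! h
    exact hcyc ⟨v, h⟩
  obtain ⟨w, m, n, hm, hn⟩ := exists_zsmul_eq_and_zsmul_eq hA v y
  rcases le_or_gt 2 m.natAbs with htwo | hlt
  · refine ⟨m.natAbs, m.sign • w, htwo, ?_⟩
    rw [← natCast_zsmul, smul_smul, mul_comm, Int.sign_mul_natAbs, hm]
  · have hm_cases : m = 0 ∨ m = 1 ∨ m = -1 := by omega
    rcases hm_cases with rfl | rfl | rfl
    · exact ⟨2, 0, le_rfl, by simp [← hm]⟩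
    · exact absurd ⟨n, by simpa [← hm] using hn⟩ hy
    · exact absurd ⟨-n, by simpa [← hm] using hn⟩ hy

theorem frequently_exists_nsmul_eq (hA : Module.rank ℤ A ≤ 1) (hcyc : ¬ IsAddCyclic A) (u : A) :
    ∃ᶠ N : ℕ in Filter.atTop, ∃ v, N • v = u := by
  refine Filter.frequently_atTop.2 fun N => ?_
  induction N with
  | zero => exact ⟨1, Nat.zero_le 1, u, one_smul ℕ u⟩
  | succ N ih =>
    obtain ⟨M, hNM, v, rfl⟩ := ih
    obtain ⟨n, w, hn, rfl⟩ := exists_nsmul_eq_of_not_isAddCyclic hA hcyc v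
    rcases M.eq_zero_or_pos with rfl | hM
    · exact ⟨N + 1, le_rfl, 0, by simp⟩
    · exact ⟨M * n, by nlinarith, w, mul_smul M n w⟩

end RankOne

theorem exists_zsmul_eq_of_range_le_zmultiples {M A : Type*} [AddCommGroup M] [AddCommGroup A]
    [IsAddTorsionFree A] {u : A} (hu : u ≠ 0) {f : M →+ A}
    (hf : f.range ≤ AddSubgroup.zmultiples u) : ∃ κ : M →+ ℤ, ∀ x, κ x • u = f x := by
  let e := AddMonoidHom.ofInjective (f := zmultiplesHom A u) fun m n h =>
    smul_left_injective ℤ hu h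
  refine ⟨e.symm.toAddMonoidHom.comp (f.codRestrict (zmultiplesHom A u).range
    fun x => hf ⟨x, rfl⟩), fun x => ?_⟩
  exact congrArg Subtype.val (e.apply_symm_apply ⟨f x, hf ⟨x, rfl⟩⟩)

section Circle

theorem exists_injective_forall_mem_notMem {ι α : Type*} [Fintype ι] (S : ι → Finset α)
    (F : Finset α) (hS : ∀ i, Fintype.card ι + F.card ≤ (S i).card) :
    ∃ p : ι → α, Function.Injective p ∧ ∀ i, p i ∈ S i ∧ p i ∉ F := by
  classical
  have hcard (i : ι) : Fintype.card ι ≤ (S i \ F).card :=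
    (Nat.le_sub_of_add_le (hS i)).trans (Finset.le_card_sdiff F (S i))
  obtain ⟨p, hp, hpS⟩ := (Finset.all_card_le_biUnion_card_iff_exists_injective (S · \ F)).1
    fun t => by
      rcases t.eq_empty_or_nonempty with rfl | ⟨i, hi⟩
      · simp
      · exact (t.card_le_univ.trans (hcard i)).trans
          (Finset.card_le_card (Finset.subset_biUnion_of_mem (S · \ F) hi))
  exact ⟨p, hp, fun i => Finset.mem_sdiff.1 (hpS i)⟩

theorem injOn_fract_add_div (t : ℝ) (N : ℕ) :
    Set.InjOn (fun c : ℕ => Int.fract (t + c / N)) (Set.Iio N) := by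
  intro a ha b hb hab
  have hN : (N : ℝ) ≠ 0 := Nat.cast_ne_zero.2 (Nat.ne_zero_of_lt ha)
  obtain ⟨z, hz⟩ := Int.fract_eq_fract.1 hab.symm
  have hdiff : (b : ℝ) - a = N * z := by
    field_simp at hz
    linarith
  have hmod : a ≡ b [MOD N] := Nat.modEq_iff_dvd.2 ⟨z, mod_cast hdiff⟩
  exact hmod.eq_of_lt_of_lt ha hb

theorem exists_shift_fract_injective {k m N : ℕ} (hmN : m ≤ N) (F : Finset ℝ)
    (hm : k + F.card ≤ m) (t : Fin k → ℝ) :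
    ∃ c : Fin k → ℕ, (∀ j, c j < m) ∧ Function.Injective (fun j => Int.fract (t j + c j / N)) ∧
      ∀ j, Int.fract (t j + c j / N) ∉ F := by
  classical
  let S (j : Fin k) := (Finset.range m).image fun c : ℕ => Int.fract (t j + c / N)
  have hS (j : Fin k) : (S j).card = m := by
    rw [Finset.card_image_of_injOn, Finset.card_range]
    exact (injOn_fract_add_div (t j) N).mono fun c hc => (Finset.mem_range.1 hc).trans_le hmN
  obtain ⟨p, hp, hpS⟩ := exists_injective_forall_mem_notMem S F fun j => by simpa [hS] using hm
  choose c hc hcp using fun j => Finset.mem_image.1 (hpS j).1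
  refine ⟨c, fun j => Finset.mem_range.1 (hc j), ?_, fun j => ?_⟩
  · simpa only [hcp] using hp
  · simpa only [hcp] using (hpS j).2

variable {G : Type*} [AddCommGroup G]

theorem sum_ite_smul_succ_sub_castSucc {n : ℕ} (Z : Fin (n + 1) → G) (m : Fin (n + 1)) :
    ∑ i : Fin n, (if i.castSucc < m then 1 else 0 : ℤ) • (Z i.succ - Z i.castSucc) = Z m - Z 0 := by
  induction m using Fin.induction with
  | zero => simp
  | succ j ih =>
    have hstep (i : Fin n) : (if i.castSucc < j.succ then 1 else 0 : ℤ) =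
        (if i.castSucc < j.castSucc then 1 else 0) + if i = j then 1 else 0 := by
      grind
    have hj : ∑ i : Fin n, (if i = j then 1 else 0 : ℤ) • (Z i.succ - Z i.castSucc) =
        Z j.succ - Z j.castSucc := by simp
    simp only [hstep, add_smul, Finset.sum_add_distrib, ih, hj]
    abel

theorem exists_perm_strictMono_comp {α : Type*} [LinearOrder α] {n : ℕ} {r : Fin (n + 1) → α}
    (hr : Function.Injective r) (h0 : ∀ i, r 0 ≤ r i) :
    ∃ e : Equiv.Perm (Fin (n + 1)), e 0 = 0 ∧ StrictMono (r ∘ e) := by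
  have hmono : StrictMono (r ∘ Tuple.sort r) :=
    (Tuple.monotone_sort r).strictMono_of_injective (hr.comp (Tuple.sort r).injective)
  refine ⟨Tuple.sort r, ?_, hmono⟩
  rw [← Equiv.eq_symm_apply, eq_comm, ← Fin.le_zero_iff, ← hmono.le_iff_le]
  simp [h0]

/-- The points `y j` cut the circle `ℝ / ℤ` into arcs, which lift to the `g i`. -/
theorem exists_arcs (θ : G →+ ℝ) {u : G} (hu : θ u = 1) {s : ℕ} {y : Fin (s + 1) → G}
    (hy0 : y 0 = 0) (hy : Function.Injective fun i => Int.fract (θ (y i))) :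
    ∃ (g : Fin (s + 1) → G) (w : Fin (s + 1) → Fin (s + 1) → ℤ), (∀ i, 0 < θ (g i)) ∧
      ∑ i, g i = u ∧ (∀ j, ∑ i, w j i • g i = y j) ∧ ∀ j i, |(w j i : ℝ) - θ (y j)| ≤ 1 := by
  let r (i : Fin (s + 1)) : ℝ := Int.fract (θ (y i))
  let z (i : Fin (s + 1)) : G := y i - ⌊θ (y i)⌋ • u
  have hθz (i : Fin (s + 1)) : θ (z i) = r i := by simp [z, r, hu, Int.self_sub_floor]
  obtain ⟨e, he0, hmono⟩ := exists_perm_strictMono_comp (r := r) hy fun i => by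
    simp [r, hy0]
  let Z : Fin (s + 2) → G := Fin.snoc (z ∘ e) u
  have hZ (i : Fin (s + 1)) : Z i.castSucc = z (e i) := Fin.snoc_castSucc (α := fun _ => G) _ _ i
  have hZ0 : Z 0 = 0 := by
    simpa [z, he0, hy0] using hZ 0
  have hZlast : Z (Fin.last (s + 1)) = u := Fin.snoc_last _ _
  have hZlt (i : Fin (s + 1)) : θ (Z i.castSucc) < θ (Z i.succ) := by
    rw [hZ, hθz]
    induction i using Fin.lastCases with
    | last => simpa only [Fin.succ_last, hZlast, hu] using Int.fract_lt_one _
    | cast i =>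
      rw [Fin.succ_castSucc, hZ, hθz]
      exact hmono i.castSucc_lt_succ
  let g (i : Fin (s + 1)) : G := Z i.succ - Z i.castSucc
  have hsum : ∑ i, g i = u := by
    simpa [g, hZ0, hZlast, Fin.castSucc_lt_last] using
      sum_ite_smul_succ_sub_castSucc Z (Fin.last (s + 1))
  refine ⟨g, fun j i => ⌊θ (y j)⌋ + if i.castSucc < (e.symm j).castSucc then 1 else 0,
    fun i => by simpa [g] using hZlt i, hsum, fun j => ?_, fun j i => ?_⟩
  · have harc : ∑ i, (if i.castSucc < (e.symm j).castSucc then 1 else 0 : ℤ) • g i = z j := by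
      simpa [g, hZ, hZ0] using sum_ite_smul_succ_sub_castSucc Z (e.symm j).castSucc
    simp only [add_smul, Finset.sum_add_distrib, ← Finset.smul_sum, hsum, harc, z,
      add_sub_cancel]
  · have hfloor := Int.floor_le (θ (y j))
    have hlt := Int.lt_floor_add_one (θ (y j))
    dsimp only
    rw [abs_le]
    split_ifs <;> push_cast <;> constructor <;> linarith

theorem exists_shift_cons_fract_injective (θ : G →+ ℝ) {h : G} {k N : ℕ} (hN : k + 2 ≤ N)
    (hθh : θ h = 1 / N) (l : Fin k → G) :
    ∃ c : Fin k → ℕ, (∀ j, c j < k + 2) ∧ Function.Injective fun i =>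
      Int.fract (θ ((Fin.cons 0 (Fin.cons h fun j => l j + c j • h) : Fin (k + 2) → G) i)) := by
  have hN1 : (1 : ℝ) < N := by exact_mod_cast (by omega : 1 < N)
  have hθ_fract : Int.fract (θ h) = 1 / N := by
    rw [hθh]
    exact Int.fract_eq_self.2 ⟨by positivity, (div_lt_one (by positivity)).2 hN1⟩
  obtain ⟨c, hc, hinj, havoid⟩ := exists_shift_fract_injective hN {0, 1 / (N : ℝ)}
    (Nat.add_le_add_left Finset.card_le_two k) fun j => θ (l j)
  have hθshift (j : Fin k) : θ (l j + c j • h) = θ (l j) + c j / N := by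
    simp [hθh, div_eq_mul_inv]
  have hcons : (fun i => Int.fract (θ ((Fin.cons 0 (Fin.cons h fun j => l j + c j • h) :
      Fin (k + 2) → G) i))) =
      Fin.cons 0 (Fin.cons (1 / (N : ℝ)) fun j => Int.fract (θ (l j) + c j / N)) := by
    funext i
    refine Fin.cases ?_ (Fin.cases ?_ fun j => ?_) i
    · simp
    · simp only [Fin.cons_succ, Fin.cons_zero, hθ_fract]
    · simp only [Fin.cons_succ, hθshift]
  refine ⟨c, hc, ?_⟩
  simp only [Finset.mem_insert, Finset.mem_singleton, not_or] at havoid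
  rw [hcons, Fin.cons_injective_iff, Fin.cons_injective_iff]
  refine ⟨?_, fun ⟨j, hj⟩ => (havoid j).2 hj, hinj⟩
  rintro ⟨i, hi⟩
  induction i using Fin.cases with
  | zero => exact absurd hi (by simp; omega)
  | succ j => exact (havoid j).1 hi

/-- Besides `0`, the point `h` itself is a cut, so that shifts of the `l j` by multiples of `h` can
be undone. -/
theorem exists_balanced_generators (θ : G →+ ℝ) {h : G} {k N : ℕ} (hN : k + 2 ≤ N)
    (hθ : θ (N • h) = 1) (l : Fin k → G) :
    ∃ (g : Fin (k + 2) → G) (w : Fin k → Fin (k + 2) → ℤ), (∀ i, 0 < θ (g i)) ∧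
      ∑ i, g i = N • h ∧ (∀ j, ∑ i, w j i • g i = l j) ∧
      ∀ j i, |(w j i : ℝ) - θ (l j)| ≤ k + 2 := by
  have hθh : θ h = 1 / N := by
    rw [map_nsmul, nsmul_eq_mul] at hθ
    exact eq_one_div_of_mul_eq_one_right hθ
  obtain ⟨c, hc, hinj⟩ := exists_shift_cons_fract_injective θ hN hθh l
  obtain ⟨g, w, hg, hsum, hw, hw_le⟩ := exists_arcs θ hθ rfl hinj
  have hwh : ∑ i, w 1 i • g i = h := hw 1
  have hwl (j : Fin k) : ∑ i, w j.succ.succ i • g i = l j + c j • h := hw j.succ.succ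
  refine ⟨g, fun j => w j.succ.succ - c j • w 1, hg, hsum, fun j => ?_, fun j i => ?_⟩
  · simp [sub_smul, mul_smul, ← Finset.smul_sum, hwh, hwl]
  · have hle_h : |(w 1 i : ℝ) - 1 / N| ≤ 1 := hθh ▸ hw_le 1 i
    have hle_l : |(w j.succ.succ i : ℝ) - θ (l j + c j • h)| ≤ 1 := hw_le j.succ.succ i
    have hcj : (c j : ℝ) ≤ k + 1 := by exact_mod_cast Nat.le_of_lt_succ (hc j)
    calc |((w j.succ.succ - c j • w 1) i : ℤ) - θ (l j)|
        = |((w j.succ.succ i : ℝ) - θ (l j + c j • h)) - c j * (w 1 i - 1 / N)| := by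
          simp [hθh]
          ring_nf
      _ ≤ |(w j.succ.succ i : ℝ) - θ (l j + c j • h)| + c j * |(w 1 i : ℝ) - 1 / N| := by
          refine (abs_sub _ _).trans_eq ?_
          rw [abs_mul, Nat.abs_cast]
      _ ≤ 1 + (k + 1) * 1 := by gcongr
      _ = k + 2 := by ring

end Circle

section Factorization

theorem exists_sum_smul_eq_of_finrank_le {R F : Type*} [CommRing R] [StrongRankCondition R]
    [AddCommGroup F] [Module R F] [Module.Free R F] [Module.Finite R F] {k : ℕ}
    (hk : Module.finrank R F ≤ k) :
    ∃ (v : Fin k → F) (β : F →ₗ[R] (Fin k → R)), ∀ x, ∑ j, β x j • v j = x := by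
  let p : (Fin k → R) →ₗ[R] F := (Module.finBasis R F).equivFun.symm.toLinearMap ∘ₗ
    LinearMap.funLeft R R (Fin.castLE hk)
  have hp : Function.Surjective p := (Module.finBasis R F).equivFun.symm.surjective.comp
    (LinearMap.funLeft_surjective_of_injective R R _ (Fin.castLE_injective hk))
  obtain ⟨β, hβ⟩ := Module.projective_lifting_property p LinearMap.id hp
  refine ⟨fun j => p (Pi.single j 1), β, fun x => ?_⟩
  have hpβ : p (∑ j, β x j • Pi.single j 1) = x := by
    rw [← pi_eq_sum_univ']
    exact LinearMap.congr_fun hβ x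
  simpa only [map_sum, map_smul] using hpβ

variable {G : Type*} [AddCommGroup G] {H M : AddSubgroup G} {k : ℕ}

theorem exists_sub_sum_smul_mem [AddGroup.FG M] [IsAddTorsionFree (G ⧸ H)]
    (hk : Module.finrank ℤ (M.map (QuotientAddGroup.mk' H)) ≤ k) :
    ∃ (l : Fin k → G) (β : M →+ (Fin k → ℤ)), (∀ x : M, (x : G) - ∑ j, β x j • l j ∈ H) ∧
      ∀ x : M, (x : G) ∈ H → β x = 0 := by
  have : Module.Finite ℤ (M.map (QuotientAddGroup.mk' H)) :=
    Module.Finite.iff_addGroup_fg.2 (AddGroup.fg_of_surjective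
      ((QuotientAddGroup.mk' H).addSubgroupMap_surjective M))
  have : Module.Free ℤ (M.map (QuotientAddGroup.mk' H)) := Module.free_of_finite_type_torsion_free'
  obtain ⟨v, β, hβ⟩ := exists_sum_smul_eq_of_finrank_le hk
  choose l hl using fun j => QuotientAddGroup.mk'_surjective H (v j)
  let π : M →+ M.map (QuotientAddGroup.mk' H) := (QuotientAddGroup.mk' H).addSubgroupMap M
  refine ⟨l, β.toAddMonoidHom.comp π, fun x => ?_, fun x hx => ?_⟩
  · rw [← QuotientAddGroup.eq_zero_iff]
    have hsum : ∑ j, β (π x) j • (v j : G ⧸ H) = (x : G) := by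
      refine Eq.trans ?_ (congrArg Subtype.val (hβ (π x)))
      simp
    have hl' (j : Fin k) : (l j : G ⧸ H) = v j := hl j
    simp [hl', hsum]
  · have hπ : π x = 0 := Subtype.ext ((QuotientAddGroup.eq_zero_iff _).2 hx)
    simp [hπ]

/-- Coordinates on `M` with respect to an element `unit` of `H` and `k` elements `lift j` of `G`,
chosen so that the coordinates along the `lift j` only depend on the class modulo `H`. -/
structure Decomposition (H M : AddSubgroup G) (k : ℕ) where
  unit : H
  lift : Fin k → G
  unitCoord : M →+ ℤ
  liftCoord : M →+ (Fin k → ℤ)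
  sum_eq : ∀ x, unitCoord x • (unit : G) + ∑ j, liftCoord x j • lift j = x
  liftCoord_eq_zero : ∀ x : M, (x : G) ∈ H → liftCoord x = 0

theorem exists_decomposition [IsAddTorsionFree G] (hH : Module.rank ℤ H ≤ 1) {τ : G →+ ℝ}
    (hτ : τ.comp H.subtype ≠ 0) [AddGroup.FG M] [IsAddTorsionFree (G ⧸ H)]
    (hk : Module.finrank ℤ (M.map (QuotientAddGroup.mk' H)) ≤ k) :
    ∃ D : Decomposition H M k, 0 < τ D.unit := by
  obtain ⟨l, β, hβ, hβ0⟩ := exists_sub_sum_smul_mem hk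
  let ρ : M →+ H := (M.subtype - (Fintype.linearCombination ℤ l).toAddMonoidHom.comp β).codRestrict
    H hβ
  obtain ⟨u, hu, hle⟩ := exists_map_pos_le_zmultiples_of_fg hH hτ
    ((AddGroup.fg_iff_addSubgroup_fg ρ.range).1 inferInstance)
  obtain ⟨κ, hκ⟩ := exists_zsmul_eq_of_range_le_zmultiples (by rintro rfl; simp at hu) hle
  refine ⟨⟨u, l, κ, β, fun x => ?_, hβ0⟩, hu⟩
  have hρ : κ x • (u : G) = x - ∑ j, β x j • l j := congrArg Subtype.val (hκ x)
  rw [hρ, sub_add_cancel]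

/-- A factorization `M → ℤ ^ s → G` of the inclusion, given by `coord` and by the images `gen i` of
the standard basis, that matches `H` with the multiples of `(1, …, 1)`. -/
structure Factorization (H M : AddSubgroup G) (s : ℕ) where
  gen : Fin s → G
  coord : M →+ (Fin s → ℤ)
  sum_coord_smul_gen : ∀ x, ∑ i, coord x i • gen i = x
  sum_gen_mem : ∑ i, gen i ∈ H
  exists_coord_eq : ∀ x : M, (x : G) ∈ H → ∃ z : ℤ, ∀ i, coord x i = z

theorem Decomposition.map_eq (D : Decomposition H M k) (θ : G →+ ℝ) (x : M) :
    θ x = D.unitCoord x * θ D.unit + ∑ j, D.liftCoord x j * θ (D.lift j) := by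
  simpa only [map_add, map_sum, map_zsmul, zsmul_eq_mul] using (congrArg θ (D.sum_eq x)).symm

theorem Decomposition.sum_smul_eq (D : Decomposition H M k) {ι : Type*} [Fintype ι] {g : ι → G}
    {w : Fin k → ι → ℤ} {n : ℕ} (hg : n • ∑ i, g i = D.unit)
    (hw : ∀ j, ∑ i, w j i • g i = D.lift j) (x : M) :
    ∑ i, (n * D.unitCoord x + ∑ j, D.liftCoord x j * w j i) • g i = x := by
  have hunit : (n * D.unitCoord x) • ∑ i, g i = D.unitCoord x • (D.unit : G) := by
    rw [mul_comm, mul_smul, natCast_zsmul, hg]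
  have hlift : ∑ i, (∑ j, D.liftCoord x j * w j i) • g i = ∑ j, D.liftCoord x j • D.lift j := by
    simp only [Finset.sum_smul, mul_smul]
    rw [Finset.sum_comm]
    simp only [← Finset.smul_sum, hw]
  simpa only [add_smul, Finset.sum_add_distrib, ← Finset.smul_sum, hunit, hlift] using D.sum_eq x

/-- Dividing the unit of a decomposition makes all coordinates of `x` nearly equal, with an error
that does not depend on the divisor `n`. -/
theorem Decomposition.exists_factorization (D : Decomposition H M k) {θ : G →+ ℝ} {n N : ℕ}
    {h : H} (hN : k + 2 ≤ N) (hθ : θ (N • h : H) = 1) (hn : n • (N • h) = D.unit) :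
    ∃ F : Factorization H M (k + 2), (∀ i, 0 < θ (F.gen i)) ∧ ∀ (x : M) (i : Fin (k + 2)),
      |F.coord x i - θ x| ≤ ∑ j, |(D.liftCoord x j : ℝ)| * (k + 2) := by
  obtain ⟨g, w, hg, hsum, hw, hle⟩ := exists_balanced_generators θ (h := (h : G)) hN hθ D.lift
  let coord : M →+ (Fin (k + 2) → ℤ) := AddMonoidHom.mk'
    (fun x i => n * D.unitCoord x + ∑ j, D.liftCoord x j * w j i) fun x y => by
      ext i
      simp only [map_add, Pi.add_apply, add_mul, Finset.sum_add_distrib]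
      ring
  refine ⟨⟨g, coord, D.sum_smul_eq ?_ hw, hsum ▸ (N • h).2, fun x hx => ⟨n * D.unitCoord x,
    fun i => ?_⟩⟩, hg, fun x i => ?_⟩
  · rw [hsum]
    exact congrArg Subtype.val hn
  · simp [coord, D.liftCoord_eq_zero x hx]
  · have hθ_unit : θ D.unit = n := by
      rw [← hn, AddSubgroup.coe_nsmul, map_nsmul, hθ, nsmul_one]
    have hcoord : (coord x i : ℝ) - θ x =
        ∑ j, (D.liftCoord x j : ℝ) * (w j i - θ (D.lift j)) := by
      simp only [coord, D.map_eq θ x, hθ_unit, AddMonoidHom.mk'_apply, Int.cast_add, Int.cast_mul,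
        Int.cast_sum, Int.cast_natCast, mul_sub, Finset.sum_sub_distrib]
      ring
    rw [hcoord]
    refine (Finset.abs_sum_le_sum_abs _ _).trans (Finset.sum_le_sum fun j _ => ?_)
    rw [abs_mul]
    exact mul_le_mul_of_nonneg_left (hle j i) (abs_nonneg _)

theorem exists_factorization_coord_nonneg [IsAddTorsionFree G] (hH : Module.rank ℤ H ≤ 1)
    (hcyc : ¬ IsAddCyclic H) {τ : G →+ ℝ} (hτ : τ.comp H.subtype ≠ 0) [IsAddTorsionFree (G ⧸ H)]
    (T : Finset G)
    (hk : Module.finrank ℤ ((AddSubgroup.closure (T : Set G)).map (QuotientAddGroup.mk' H)) ≤ k) :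
    ∃ F : Factorization H (AddSubgroup.closure (T : Set G)) (k + 2), (∀ i, 0 < τ (F.gen i)) ∧
      ∀ x : T, 0 < τ x → ∀ i, 0 ≤ F.coord ⟨x, AddSubgroup.subset_closure x.2⟩ i := by
  obtain ⟨D, hD⟩ := exists_decomposition hH hτ hk
  let error (x : T) : ℝ :=
    ∑ j, |(D.liftCoord ⟨x, AddSubgroup.subset_closure x.2⟩ j : ℝ)| * (k + 2)
  have hlarge : ∀ᶠ n : ℕ in Filter.atTop, ∀ x : T, 0 < τ x → error x ≤ n * (τ x / τ D.unit) :=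
    Filter.eventually_all.2 fun x => by
      by_cases hx : 0 < τ x
      · exact ((tendsto_natCast_atTop_atTop.atTop_mul_const
          (div_pos hx hD)).eventually_ge_atTop (error x)).mono fun n hn _ => hn
      · exact .of_forall fun n h => absurd h hx
  obtain ⟨n, ⟨u, hu⟩, hn⟩ :=
    ((frequently_exists_nsmul_eq hH hcyc D.unit).and_eventually hlarge).exists
  obtain ⟨N, ⟨h, rfl⟩, hN⟩ := ((frequently_exists_nsmul_eq hH hcyc u).and_eventually
    (Filter.eventually_ge_atTop (k + 2))).exists
  have hτD : n * τ (N • h : H) = τ D.unit := by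
    rw [← hu]
    simp
  have hτu : 0 < τ (N • h : H) := pos_of_mul_pos_right (hτD ▸ hD) n.cast_nonneg
  let θ : G →+ ℝ := (AddMonoidHom.mulRight (τ (N • h : H))⁻¹).comp τ
  have hθ (y : G) : θ y = τ y / τ (N • h : H) := (div_eq_mul_inv _ _).symm
  obtain ⟨F, hF, hcoord⟩ :=
    D.exists_factorization (θ := θ) hN ((hθ _).trans (div_self hτu.ne')) hu
  refine ⟨F, fun i => (div_pos_iff_of_pos_right hτu).1 (hθ _ ▸ hF i), fun x hx i => ?_⟩
  have hscale : n * (τ x / τ D.unit) = θ x := by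
    have hn0 : (n : ℝ) ≠ 0 := left_ne_zero_of_mul (hτD ▸ hD.ne')
    rw [hθ, ← hτD]
    field_simp
  have herror : error x ≤ θ x := hscale ▸ hn x hx
  have hlower : -error x ≤ F.coord ⟨x, AddSubgroup.subset_closure x.2⟩ i - θ x :=
    (abs_le.1 (hcoord _ i)).1
  exact Int.cast_nonneg_iff.1 (by linarith : (0 : ℝ) ≤ F.coord ⟨x, _⟩ i)

end Factorization

section Realization

section Transition

variable {f : ℕ → ℕ} (A : ∀ n, Matrix (Fin (f (n + 1))) (Fin (f n)) ℤ)

theorem transition_self (m : ℕ) (v : Fin (f m) → ℤ) : transition A m m le_rfl v = v := by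
  simp [transition, Nat.leRecOn_self]

theorem transition_succ {m n : ℕ} (h : m ≤ n) (v : Fin (f m) → ℤ) :
    transition A m (n + 1) (h.trans n.le_succ) v = (A n).mulVec (transition A m n h v) := by
  rw [transition, Nat.leRecOn_succ h]
  rfl

theorem limitClass_mulVec (n : ℕ) (v : Fin (f n) → ℤ) :
    limitClass A (n + 1) ((A n).mulVec v) = limitClass A n v := by
  have h := AddCommGroup.DirectLimit.of_f (G := fun n => Fin (f n) → ℤ) (f := transition A)
    n.le_succ v
  rwa [transition_succ A le_rfl, transition_self] at h

end Transition

variable {G : Type*} [AddCommGroup G] {H : AddSubgroup G}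

namespace Factorization

variable {M : AddSubgroup G} {s : ℕ} (F : Factorization H M s)

/-- The map `ℤ ^ s → G` of the factorization. -/
def toGroup : (Fin s → ℤ) →+ G :=
  (Fintype.linearCombination ℤ F.gen).toAddMonoidHom

theorem toGroup_apply (v : Fin s → ℤ) : F.toGroup v = ∑ i, v i • F.gen i :=
  rfl

theorem toGroup_coord (x : M) : F.toGroup (F.coord x) = x :=
  F.sum_coord_smul_gen x

theorem toGroup_const (z : ℤ) : F.toGroup (fun _ => z) = z • ∑ i, F.gen i := by
  rw [toGroup_apply, Finset.smul_sum]

theorem toGroup_mem {N : AddSubgroup G} (hN : ∀ i, F.gen i ∈ N) (v : Fin s → ℤ) :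
    F.toGroup v ∈ N := by
  rw [toGroup_apply]
  exact sum_mem fun i _ => N.zsmul_mem (hN i) (v i)

end Factorization

variable {M : ℕ → AddSubgroup G} {f : ℕ → ℕ} (F : ∀ n, Factorization H (M n) (f n))
  (hF : ∀ n j, (F n).gen j ∈ M (n + 1))

/-- The composites `ℤ ^ f n → M (n + 1) → ℤ ^ f (n + 1)`, whose limit is the union of the `M n`. -/
def stepMatrix (n : ℕ) : Matrix (Fin (f (n + 1))) (Fin (f n)) ℤ :=
  Matrix.of fun i j => (F (n + 1)).coord ⟨(F n).gen j, hF n j⟩ i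

theorem stepMatrix_mulVec (n : ℕ) (v : Fin (f n) → ℤ) :
    (stepMatrix F hF n).mulVec v =
      (F (n + 1)).coord ⟨(F n).toGroup v, (F n).toGroup_mem (hF n) v⟩ := by
  have hsum : (⟨(F n).toGroup v, (F n).toGroup_mem (hF n) v⟩ : M (n + 1)) =
      ∑ j, v j • ⟨(F n).gen j, hF n j⟩ := Subtype.ext (by simp [Factorization.toGroup_apply])
  ext i
  simp [hsum, Matrix.mulVec, dotProduct, stepMatrix, mul_comm]

theorem toGroup_transition {m n : ℕ} (h : m ≤ n) (v : Fin (f m) → ℤ) :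
    (F n).toGroup (transition (stepMatrix F hF) m n h v) = (F m).toGroup v := by
  induction n, h using Nat.le_induction with
  | base => rw [transition_self]
  | succ n h ih =>
    rw [transition_succ _ h, stepMatrix_mulVec, Factorization.toGroup_coord]
    exact ih

/-- The homomorphism from the limit to `G` induced by the maps `ℤ ^ f n → G`. -/
noncomputable def limitHom : MatrixLimit (stepMatrix F hF) →+ G :=
  AddCommGroup.DirectLimit.lift _ _ G (fun n => (F n).toGroup) fun _ _ h v =>
    toGroup_transition F hF h v

theorem limitHom_limitClass (n : ℕ) (v : Fin (f n) → ℤ) :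
    limitHom F hF (limitClass _ n v) = (F n).toGroup v :=
  AddCommGroup.DirectLimit.lift_of _ _ _ _ _

theorem limitHom_injective : Function.Injective (limitHom F hF) := by
  refine (injective_iff_map_eq_zero _).2 fun x => ?_
  induction x using AddCommGroup.DirectLimit.induction_on with
  | _ n v =>
    intro hv
    have hv0 : (F n).toGroup v = 0 := (limitHom_limitClass F hF n v).symm.trans hv
    have hstep : (stepMatrix F hF n).mulVec v = 0 := by
      rw [stepMatrix_mulVec]
      simp only [hv0]
      exact map_zero _
    change limitClass _ n v = 0
    rw [← limitClass_mulVec, hstep, map_zero]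

variable (hM : ∀ x, ∃ n, x ∈ M n)

/-- The identification of `G` with the limit of the step matrices. -/
noncomputable def limitEquiv : G ≃+ MatrixLimit (stepMatrix F hF) :=
  (AddEquiv.ofBijective (limitHom F hF) ⟨limitHom_injective F hF, fun x =>
    let ⟨n, hx⟩ := hM x
    ⟨limitClass _ n ((F n).coord ⟨x, hx⟩), by
      rw [limitHom_limitClass, Factorization.toGroup_coord]⟩⟩).symm

theorem limitEquiv_toGroup (n : ℕ) (v : Fin (f n) → ℤ) :
    limitEquiv F hF hM ((F n).toGroup v) = limitClass _ n v :=
  (AddEquiv.symm_apply_eq _).2 (limitHom_limitClass F hF n v).symm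

theorem limitEquiv_coe (n : ℕ) (x : M n) :
    limitEquiv F hF hM x = limitClass _ n ((F n).coord x) := by
  rw [← limitEquiv_toGroup F hF hM, Factorization.toGroup_coord]

theorem limitEquiv_image : limitEquiv F hF hM '' (H : Set G) =
    ⋃ n, {x | ∃ z : ℤ, x = z • limitClass (stepMatrix F hF) n (fun _ => 1)} := by
  ext x
  simp only [Set.mem_image, SetLike.mem_coe, Set.mem_iUnion, Set.mem_ofPred_eq]
  constructor
  · rintro ⟨g, hg, rfl⟩
    obtain ⟨n, hn⟩ := hM g
    obtain ⟨z, hz⟩ := (F n).exists_coord_eq ⟨g, hn⟩ hg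
    have hcoord : (F n).coord ⟨g, hn⟩ = z • fun _ => 1 := by
      ext i
      simp [hz]
    exact ⟨n, z, by rw [← map_zsmul, ← hcoord, ← limitEquiv_coe F hF hM]⟩
  · rintro ⟨n, z, rfl⟩
    refine ⟨z • (F n).toGroup fun _ => 1, H.zsmul_mem ?_ z, ?_⟩
    · simpa [Factorization.toGroup_const] using (F n).sum_gen_mem
    · rw [map_zsmul, limitEquiv_toGroup]

section Order

variable [PartialOrder G] [IsOrderedAddMonoid G] (hpos : ∀ n i, 0 < (F n).gen i)
include hpos

theorem nonneg_iff_limitEquiv_mem_limitCone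
    (hcoord : ∀ x : G, 0 < x → ∃ (n : ℕ) (hx : x ∈ M n), ∀ i, 0 ≤ (F n).coord ⟨x, hx⟩ i) (g : G) :
    0 ≤ g ↔ limitEquiv F hF hM g ∈ limitCone (stepMatrix F hF) := by
  constructor
  · intro hg
    rcases hg.eq_or_lt with rfl | hg
    · exact ⟨0, 0, fun _ => le_rfl, by simp⟩
    · obtain ⟨n, hn, hnonneg⟩ := hcoord g hg
      exact ⟨n, _, hnonneg, limitEquiv_coe F hF hM n ⟨g, hn⟩⟩
  · rintro ⟨n, v, hv, hg⟩
    rw [← limitEquiv_toGroup F hF hM, EmbeddingLike.apply_eq_iff_eq] at hg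
    rw [hg, Factorization.toGroup_apply]
    exact Finset.sum_nonneg fun i _ => zsmul_nonneg (hpos n i).le (hv i)

theorem exists_pos_sum_stepMatrix_eq (hf : ∀ n, 0 < f n) (n : ℕ) :
    ∃ p : ℤ, 0 < p ∧ ∀ i, ∑ j, stepMatrix F hF n i j = p := by
  have hsum_pos (m : ℕ) : 0 < ∑ i, (F m).gen i :=
    have : NeZero (f m) := ⟨(hf m).ne'⟩
    Finset.sum_pos (fun i _ => hpos m i) Finset.univ_nonempty
  have hmem : ∑ j, (F n).gen j ∈ M (n + 1) := sum_mem fun j _ => hF n j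
  obtain ⟨p, hp⟩ := (F (n + 1)).exists_coord_eq ⟨_, hmem⟩ (F n).sum_gen_mem
  refine ⟨p, ?_, fun i => ?_⟩
  · have hgen : ∑ j, (F n).gen j = p • ∑ i, (F (n + 1)).gen i := by
      rw [← Factorization.toGroup_const, ← funext hp, Factorization.toGroup_coord]
    by_contra! hp0
    have hneg : (-p) • ∑ i, (F (n + 1)).gen i < 0 := by
      rw [neg_smul, ← hgen]
      exact neg_neg_of_pos (hsum_pos n)
    exact hneg.not_ge (zsmul_nonneg (hsum_pos (n + 1)).le (neg_nonneg.2 hp0))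
  · have hstep : (stepMatrix F hF n).mulVec 1 = (F (n + 1)).coord ⟨_, hmem⟩ := by
      rw [stepMatrix_mulVec]
      congr 2
      simp [Factorization.toGroup_apply]
    rw [← hp i, ← hstep]
    simp only [Matrix.mulVec, dotProduct, Pi.one_apply, mul_one]

include hM in
theorem exists_ersRealization (hf : ∀ n, 0 < f n) (hstep : ∀ n i j, 0 ≤ stepMatrix F hF n i j)
    (hcoord : ∀ x : G, 0 < x → ∃ (n : ℕ) (hx : x ∈ M n), ∀ i, 0 ≤ (F n).coord ⟨x, hx⟩ i) :
    ∃ R : ERSRealization G H, ∀ n, R.size n = f n := by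
  choose p hp hsum using exists_pos_sum_stepMatrix_eq F hF hpos hf
  exact ⟨{
    size := f
    size_pos := hf
    mat := stepMatrix F hF
    mat_nonneg := hstep
    rowSum := p
    rowSum_pos := hp
    sum_row := hsum
    iso := limitEquiv F hF hM
    iso_order := nonneg_iff_limitEquiv_mem_limitCone F hF hM hpos hcoord
    iso_image := limitEquiv_image F hF hM }, fun _ => rfl⟩

end Order

end Realization

section Exhaustion

variable {G : Type*} [AddCommGroup G] [PartialOrder G] [IsOrderedAddMonoid G]
  [IsAddTorsionFree G] [Countable G] {H : AddSubgroup G} [IsAddTorsionFree (G ⧸ H)]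

theorem exists_ersRealization_of_pos_iff (hH : Module.rank ℤ H ≤ 1) (hcyc : ¬ IsAddCyclic H)
    {τ : G →+ ℝ} (hτ : τ.comp H.subtype ≠ 0) (hpos : ∀ g, 0 < g ↔ 0 < τ g) {κ : Finset G → ℕ}
    (hκ : ∀ T : Finset G, Module.finrank ℤ
      ((AddSubgroup.closure (T : Set G)).map (QuotientAddGroup.mk' H)) ≤ κ T) :
    ∃ R : ERSRealization G H, ∀ n, ∃ T, R.size n = κ T + 2 := by
  classical
  choose F hgen hcoord using fun T => exists_factorization_coord_nonneg hH hcyc hτ T (hκ T)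
  obtain ⟨x, hx⟩ := exists_surjective_nat G
  obtain ⟨T, hx_mem, hgen_mem⟩ : ∃ T : ℕ → Finset G,
      (∀ n, x n ∈ T (n + 1)) ∧ ∀ n j, (F (T n)).gen j ∈ T (n + 1) :=
    ⟨fun n => n.rec ∅ fun n T => insert (x n) (Finset.univ.image (F T).gen),
      fun _ => Finset.mem_insert_self _ _, fun _ j =>
        Finset.mem_insert_of_mem (Finset.mem_image_of_mem _ (Finset.mem_univ j))⟩
  have hexhaust (y : G) : ∃ n : ℕ, y ∈ AddSubgroup.closure (T n : Set G) := by
    obtain ⟨n, rfl⟩ := hx y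
    exact ⟨n + 1, AddSubgroup.subset_closure (hx_mem n)⟩
  have hnonneg (y : G) (hy : 0 < y) :
      ∃ (n : ℕ) (hn : y ∈ AddSubgroup.closure (T n : Set G)), ∀ i,
        0 ≤ (F (T n)).coord ⟨y, hn⟩ i := by
    obtain ⟨n, rfl⟩ := hx y
    exact ⟨n + 1, _, hcoord (T (n + 1)) ⟨x n, hx_mem n⟩ ((hpos _).1 hy)⟩
  obtain ⟨R, hR⟩ := exists_ersRealization (fun n => F (T n))
    (fun n j => AddSubgroup.subset_closure (hgen_mem n j)) hexhaust
    (fun n i => (hpos _).2 (hgen _ i)) (fun n => Nat.succ_pos _)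
    (fun n i j => hcoord (T (n + 1)) ⟨_, hgen_mem n j⟩ (hgen _ j) i) hnonneg
  exact ⟨R, fun n => ⟨T n, hR n⟩⟩

end Exhaustion

section NearlySplit

variable {G : Type*} [AddCommGroup G]

theorem fg_quotient_of_le {H K : AddSubgroup G} (hHK : H ≤ K) [AddGroup.FG (G ⧸ H)] :
    AddGroup.FG (G ⧸ K) :=
  AddGroup.fg_of_surjective (QuotientAddGroup.map_surjective_of_surjective H K (AddMonoidHom.id G)
    (QuotientAddGroup.mk'_surjective K) hHK)

theorem finiteIndex_of_forall_zsmul_mem {J : AddSubgroup G} [AddGroup.FG (G ⧸ J)]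
    (hJ : ∀ x, ∃ n : ℤ, n ≠ 0 ∧ n • x ∈ J) : J.FiniteIndex := by
  refine AddSubgroup.finiteIndex_iff_finite_quotient.2
    (AddCommGroup.finite_of_fg_isAddTorsion _ fun q => ?_)
  induction q using QuotientAddGroup.induction_on with | H x
  obtain ⟨n, hn, hx⟩ := hJ x
  exact isOfFinAddOrder_iff_zsmul_eq_zero.2 ⟨n, hn, (QuotientAddGroup.eq_zero_iff (n • x)).2 hx⟩

theorem exists_disjoint_forall_zsmul_mem_sup (K : AddSubgroup G) [AddGroup.FG (G ⧸ K)] :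
    ∃ C, Disjoint K C ∧ ∀ x, ∃ n : ℤ, n ≠ 0 ∧ n • x ∈ K ⊔ C := by
  let torsion := Submodule.torsion ℤ (G ⧸ K)
  let π : G →ₗ[ℤ] (G ⧸ K) ⧸ torsion := torsion.mkQ ∘ₗ (QuotientAddGroup.mk' K).toIntLinearMap
  have hπ : Function.Surjective π :=
    torsion.mkQ_surjective.comp (QuotientAddGroup.mk'_surjective K)
  have : Module.Finite ℤ (G ⧸ K) := Module.Finite.iff_addGroup_fg.2 inferInstance
  have : Module.Free ℤ ((G ⧸ K) ⧸ torsion) := Module.free_of_finite_type_torsion_free'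
  obtain ⟨s, hs⟩ := Module.projective_lifting_property π LinearMap.id hπ
  have hsection (q) : π (s q) = q := LinearMap.congr_fun hs q
  refine ⟨s.toAddMonoidHom.range, AddSubgroup.disjoint_def.2 ?_, fun x => ?_⟩
  · rintro _ hK ⟨q, rfl⟩
    have hq : π (s q) = 0 :=
      (congrArg torsion.mkQ ((QuotientAddGroup.eq_zero_iff (s q)).2 hK)).trans (map_zero _)
    simp [(hsection q).symm.trans hq]
  · have htorsion : ((x - s (π x) : G) : G ⧸ K) ∈ torsion := by
      refine (Submodule.Quotient.mk_eq_zero _).1 ?_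
      change π (x - s (π x)) = 0
      rw [map_sub, hsection, sub_self]
    obtain ⟨⟨n, hn⟩, hn0⟩ := (Submodule.mem_torsion_iff _).1 htorsion
    have hnx : n • (x - s (π x)) ∈ K := (QuotientAddGroup.eq_zero_iff _).1 hn0
    have hsum : n • x = n • (x - s (π x)) + s (n • π x) := by
      rw [map_zsmul]
      module
    exact ⟨n, nonZeroDivisors.ne_zero hn, hsum ▸ add_mem (AddSubgroup.mem_sup_left hnx)
      (AddSubgroup.mem_sup_right ⟨_, rfl⟩)⟩

theorem nearlySplit_of_disjoint_ker {V : Type*} [AddCommGroup V] {t : G →+ V} {H : AddSubgroup G}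
    (hH : Disjoint t.ker H) [AddGroup.FG (G ⧸ H)] : NearlySplit t := by
  have : AddGroup.FG (G ⧸ (t.ker ⊔ H)) := fg_quotient_of_le le_sup_right
  obtain ⟨C, hC, hindex⟩ := exists_disjoint_forall_zsmul_mem_sup (t.ker ⊔ H)
  rw [sup_assoc] at hindex
  have : AddGroup.FG (G ⧸ (t.ker ⊔ (H ⊔ C))) :=
    fg_quotient_of_le (le_sup_left.trans le_sup_right : H ≤ _)
  exact ⟨_, H ⊔ C, hH.disjoint_sup_right_of_disjoint_sup_left hC, rfl,
    finiteIndex_of_forall_zsmul_mem hindex⟩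

theorem disjoint_ker_of_comp_subtype_ne_zero [IsAddTorsionFree G] {V : Type*} [AddCommGroup V]
    [IsAddTorsionFree V] {H : AddSubgroup G} (hH : Module.rank ℤ H ≤ 1) {t : G →+ V}
    (ht : t.comp H.subtype ≠ 0) : Disjoint t.ker H := by
  refine AddSubgroup.disjoint_def.2 fun {x} hx hxH => ?_
  have hx0 : (⟨x, hxH⟩ : H) = 0 := (injective_iff_map_eq_zero _).1 (injective_of_ne_zero hH ht) _ hx
  exact congrArg Subtype.val hx0

end NearlySplit

section Rank

variable {G : Type*} [AddCommGroup G]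

theorem finrank_addSubgroup_le (B : AddSubgroup G) {k : ℕ} (hG : Module.rank ℤ G ≤ k) :
    Module.finrank ℤ B ≤ k :=
  Module.finrank_le_of_rank_le ((Submodule.rank_le (AddSubgroup.toIntSubmodule B)).trans hG)

theorem rank_quotient_eq {H : AddSubgroup G} (hH : Module.rank ℤ H = 1) {k : ℕ}
    (hG : Module.rank ℤ G = ((k + 1 : ℕ) : Cardinal)) : Module.rank ℤ (G ⧸ H) = k := by
  have hsum : Module.rank ℤ (G ⧸ H) + Module.rank ℤ H = Module.rank ℤ G :=
    rank_quotient_add_rank_of_isDomain (AddSubgroup.toIntSubmodule H)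
  rw [hH, hG, Nat.cast_add, Nat.cast_one] at hsum
  exact Cardinal.add_one_inj.1 hsum

end Rank

end ERS

theorem theorem7p1 {G : Type*} [AddCommGroup G] [PartialOrder G] [IsOrderedAddMonoid G]
    [Countable G] (hG : ERS.IsSimpleDimensionGroup G)
    (τ : G →+ ℝ) (hτ : ERS.IsUniqueTrace τ)
    (H : AddSubgroup G) (hH_rank : Module.rank ℤ H = 1) (hH_cyc : ¬ IsAddCyclic H)
    (hH_tr : H.map τ ≠ ⊥) (hH_tf : IsAddTorsionFree (G ⧸ H)) :
    (∀ k : ℕ, Module.rank ℤ G = ((k + 1 : ℕ) : Cardinal) →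
      (∃ R : ERS.ERSRealization G H, ∀ n, R.size n = k + 2) ∧
      (Module.Free ℤ (G ⧸ H) → ERS.NearlySplit τ)) ∧
    Nonempty (ERS.ERSRealization G H) := by
  have : IsAddTorsionFree G := ERS.isAddTorsionFree_of_unperforated hG.unperforated
  have hτH : τ.comp H.subtype ≠ 0 := fun h => hH_tr ((AddSubgroup.map_eq_bot_iff H).2 fun x hx =>
    AddMonoidHom.mem_ker.2 (DFunLike.congr_fun h (⟨x, hx⟩ : H)))
  have hrealize {κ : Finset G → ℕ} (hκ) := ERS.exists_ersRealization_of_pos_iff (κ := κ)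
    hH_rank.le hH_cyc hτH (hG.pos_iff_map_pos hτ) hκ
  refine ⟨fun k hk => ?_, (hrealize fun _ => le_rfl).nonempty⟩
  have hquot : Module.rank ℤ (G ⧸ H) = k := ERS.rank_quotient_eq hH_rank hk
  obtain ⟨R, hR⟩ := hrealize (κ := fun _ => k) fun _ =>
    ERS.finrank_addSubgroup_le _ hquot.le
  refine ⟨⟨R, fun n => (hR n).choose_spec⟩, fun _ => ?_⟩
  have : AddGroup.FG (G ⧸ H) :=
    Module.Finite.iff_addGroup_fg.1 (Module.finite_of_rank_eq_nat hquot)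
  exact ERS.nearlySplit_of_disjoint_ker
    (ERS.disjoint_ker_of_comp_subtype_ne_zero hH_rank.le hτH)
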